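/- Let $(\mathcal C,J)$ be a small site with finite limits and $\mathcal E=\mathbf{Sh}(\mathcal C,J)$. An *internal locale* in $\mathcal E$ is a $J$-sheaf $L$ that is pointwise a frame, whose transition maps $L(f)\colon L(c)\to L(d)$ (for $f\colon d\to c$) are frame homomorphisms with left adjoints $\exists_f\dashv L(f)$, satisfying Beck–Chevalley for pullback squares of $\mathcal C$ and Frobenius reciprocity $\exists_f(L(f)(y)\wedge x)=\exists_f(x)\wedge y$. It is an *internal Boolean algebra* if each $L(c)$ is a Boolean algebra. A Heyting algebra is a *Stone algebra* if $\neg(x\wedge y)\le\neg x\vee\neg y$ for all $x,y$; an *internal Stone algebra* in $\mathcal E$ is a sheaf of Heyting algebras, with restriction maps preserving the Heyting structure, that is pointwise a Stone algebra. A topos is *De Morgan* if its subobject classifier is an internal Stone algebra. For an internal locale $A$, let $\mathcal G(A)$ be the category of pairs $(c,x)$ with $x\in A(c)$, a morphism $(d,y)\to(c,x)$ being a morphism $f\colon d\to c$ with $y\le A(f)(x)$. Let $K$ be the Grothendieck topology on $\mathcal G(A)$ generated by the finite families $\{\mathrm{id}\colon(c,x_i)\to(c,x)\}_{i\in I}$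 with $x=\bigvee_{i\in I}x_i$, and the families $\{f_i\colon(c_i,A(f_i)(x))\to(c,x)\}_{i}$ with $\{f_i\}_i$ a $J$-covering family of $c$. The *fibred ideal completion* $\mathrm{Idl}(A)$ sends $c$ to the set of $K$-closed sieves on $(c,1)$, ordered by inclusion, with restriction by pullback of sieves. **(1)** Let $B$ be an internal locale in $\mathcal E$ that is an internal Boolean algebra. Then $\mathrm{Idl}(B)$ is an internal locale and an internal Stone algebra. Moreover, for every object $c$ and every $K$-closed sieve $R$ on $(c,1)$, the pseudo-complement of $R$ in $\mathrm{Idl}(B)(c)$ is $$\neg R=\{f\colon(d,x)\to(c,1)\mid x'=0\text{ for every }g\colon(d',x')\to(d,x)\text{ with }f g\in R\}$$ $$\phantom{\neg R}=\{f\colon(d,x)\to(c,1)\mid \exists_f(x)\wedge\exists_g(x')=0\text{ for every }g\colon(d',x')\to(c,1)\text{ in }R\},$$ and if $z=\bigvee\{\exists_h(x)\mid h\colon(d,x)\to(c,1)\text{ in }\neg R\}\in B(c)$, then $\neg R$ is the principal sieve generated by $\mathrm{id}\colon(c,z)\to(c,1)$, and $\neg\neg R$ is the principal sieve generated by $\mathrm{id}\colon(c,\neg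 z)\to(c,1)$. **(2)** Let $\Omega_{\neg\neg}$ be the equalizer of $\neg\neg,\mathrm{id}\colon\Omega\rightrightarrows\Omega$ in $\mathcal E$; that is, $\Omega_{\neg\neg}(c)$ is the set of $J$-closed sieves $S$ on $c$ with $\neg\neg S=S$. Then $\Omega_{\neg\neg}$ is an internal locale and an internal Boolean algebra; in particular $\mathrm{Idl}(\Omega_{\neg\neg})$ is an internal Stone algebra. **(3)** The Gleason cover $\gamma\mathcal E=\mathbf{Sh}(\mathcal G(\Omega_{\neg\neg}),K)$ of $\mathcal E$ is a De Morgan topos. -/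

import Mathlib

universe u v w

open CategoryTheory CategoryTheory.Limits Opposite

namespace GleasonCover

/-! ### Stone algebras -/

/-- A Heyting algebra is a Stone (or De Morgan) algebra if `¬ (x ∧ y) ≤ ¬ x ∨ ¬ y`. -/
def IsStone (H : Type*) [HeytingAlgebra H] : Prop :=
  ∀ x y : H, (x ⊓ y)ᶜ ≤ xᶜ ⊔ yᶜ

/-! ### The frame of closed sieves -/

section ClosedSieves

variable {C : Type u} [Category.{v} C] (J : GrothendieckTopology C)

/-- The `J`-closed sieves on an object `X`, ordered by inclusion. -/
@[ext]
structure ClosedSieve (X : C) : Type max u v where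
  sieve : Sieve X
  isClosed : J.IsClosed sieve

namespace ClosedSieve

variable {J} {X Y Z : C}

instance : PartialOrder (ClosedSieve J X) :=
  PartialOrder.lift ClosedSieve.sieve fun _ _ h => ClosedSieve.ext h

/-- The closure of a sieve, as a closed sieve. -/
def close (J : GrothendieckTopology C) {X : C} (S : Sieve X) : ClosedSieve J X :=
  ⟨J.close S, J.close_isClosed S⟩

theorem close_le_iff (S : Sieve X) (T : ClosedSieve J X) : close J S ≤ T ↔ S ≤ T.1 :=
  ⟨fun h => (J.le_close S).trans h, fun h => J.le_close_of_isClosed h T.2⟩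

/-- Meets of closed sieves are intersections, joins are closures of unions. -/
instance : CompleteLattice (ClosedSieve J X) where
  sup S T := close J (S.1 ⊔ T.1)
  le_sup_left _ _ := (le_sup_left).trans (J.le_close _)
  le_sup_right _ _ := (le_sup_right).trans (J.le_close _)
  sup_le _ _ _ h₁ h₂ := (close_le_iff _ _).2 (sup_le h₁ h₂)
  inf S T := ⟨S.1 ⊓ T.1, fun _ f hf =>
    ⟨S.2 f (J.superset_covering (Sieve.pullback_monotone f inf_le_left) hf),
      T.2 f (J.superset_covering (Sieve.pullback_monotone f inf_le_right) hf)⟩⟩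
  inf_le_left _ _ := inf_le_left (α := Sieve X)
  inf_le_right _ _ := inf_le_right (α := Sieve X)
  le_inf _ _ _ h₁ h₂ := le_inf (α := Sieve X) h₁ h₂
  top := ⟨⊤, fun _ _ _ => trivial⟩
  le_top _ := le_top (α := Sieve X)
  bot := close J ⊥
  bot_le T := (close_le_iff _ _).2 bot_le
  sSup A := close J (sSup (ClosedSieve.sieve '' A))
  isLUB_sSup A := ⟨fun S hS => (le_sSup (Set.mem_image_of_mem _ hS)).trans (J.le_close _),
    fun T hT => (close_le_iff _ _).2 (sSup_le (by rintro _ ⟨S, hS, rfl⟩; exact hT hS))⟩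
  sInf A := ⟨sInf (ClosedSieve.sieve '' A), fun Y f hf => by
    rintro _ ⟨S, hS, rfl⟩
    exact S.2 f (J.superset_covering
      (Sieve.pullback_monotone f (sInf_le (Set.mem_image_of_mem _ hS))) hf)⟩
  isGLB_sInf A := ⟨fun S hS => sInf_le (α := Sieve X) (Set.mem_image_of_mem _ hS),
    fun T hT => le_sInf (α := Sieve X) (by rintro _ ⟨S, hS, rfl⟩; exact hT hS)⟩

theorem le_def {S T : ClosedSieve J X} : S ≤ T ↔ ∀ ⦃Y : C⦄ (f : Y ⟶ X), S.1 f → T.1 f :=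
  ⟨fun h _ f hf => h f hf, fun h _ f hf => h f hf⟩

theorem inf_apply {S T : ClosedSieve J X} (f : Y ⟶ X) : (S ⊓ T).1 f ↔ S.1 f ∧ T.1 f :=
  Iff.rfl

theorem sSup_apply {A : Set (ClosedSieve J X)} (f : Y ⟶ X) :
    (sSup A).1 f ↔ (sSup (ClosedSieve.sieve '' A) : Sieve X).pullback f ∈ J Y :=
  Iff.rfl

theorem bot_apply (f : Y ⟶ X) : (⊥ : ClosedSieve J X).1 f ↔ (⊥ : Sieve Y) ∈ J Y := by
  have : (⊥ : Sieve X).pullback f = ⊥ := by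
    ext Z g
    rfl
  change (⊥ : Sieve X).pullback f ∈ J Y ↔ _
  rw [this]

instance : Order.Frame (ClosedSieve J X) := .ofMinimalAxioms
  { (inferInstance : CompleteLattice (ClosedSieve J X)) with
    inf_sSup_le_iSup_inf := fun S A => by
      rw [le_def]
      rintro Y f ⟨hS, hA⟩
      rw [← sSup_image]
      rw [sSup_apply] at hA ⊢
      refine J.superset_covering ?_ hA
      rintro Z g ⟨_, ⟨T, hT, rfl⟩, hg⟩
      exact ⟨_, ⟨_, ⟨T, hT, rfl⟩, rfl⟩, S.1.downward_closed hS g, hg⟩ }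

/-- Restriction of closed sieves along a morphism is a frame homomorphism. -/
def pullback (f : Y ⟶ X) : FrameHom (ClosedSieve J X) (ClosedSieve J Y) where
  toFun S := ⟨S.1.pullback f, J.isClosed_pullback f S.1 S.2⟩
  map_inf' _ _ := rfl
  map_top' := rfl
  map_sSup' A := by
    apply le_antisymm
    · refine le_def.2 fun Z g hg => ?_
      change (sSup A).1 (g ≫ f) at hg
      rw [sSup_apply] at hg ⊢
      refine J.superset_covering ?_ hg
      rintro W h ⟨_, ⟨T, hT, rfl⟩, hh⟩
      refine ⟨_, ⟨_, ⟨T, hT, rfl⟩, rfl⟩, ?_⟩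
      change T.1 ((h ≫ g) ≫ f)
      rwa [Category.assoc]
    · refine sSup_le ?_
      rintro _ ⟨T, hT, rfl⟩ Z g hg
      exact le_def.1 (le_sSup hT) _ hg

theorem pullback_apply (f : Y ⟶ X) (S : ClosedSieve J X) (g : Z ⟶ Y) :
    (pullback f S).1 g ↔ S.1 (g ≫ f) :=
  Iff.rfl

theorem compl_apply (S : ClosedSieve J X) (f : Y ⟶ X) :
    (Sᶜ).1 f ↔ ∀ ⦃Z : C⦄ (g : Z ⟶ Y), S.1 (g ≫ f) → (⊥ : Sieve Z) ∈ J Z := by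
  constructor
  · intro h Z g hg
    have h₁ : (Sᶜ ⊓ S).1 (g ≫ f) := ⟨(Sᶜ).1.downward_closed h g, hg⟩
    rw [compl_inf_self] at h₁
    exact (bot_apply _).1 h₁
  · intro h
    have h₁ : close J (Sieve.generate (Presieve.singleton f)) ≤ Sᶜ := by
      rw [le_compl_iff_disjoint_right, disjoint_iff_inf_le, le_def]
      rintro Z g ⟨hg₁, hg₂⟩
      have key : (⊥ : Sieve Z) ∈ J Z := by
        refine J.transitive hg₁ _ ?_
        rintro W k ⟨_, a, _, ⟨⟩, e⟩
        have : (⊥ : Sieve W) ∈ J W := by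
          refine h a ?_
          rw [e]
          exact S.1.downward_closed hg₂ k
        exact J.superset_covering bot_le this
      exact (bot_apply _).2 key
    exact le_def.1 h₁ f (J.le_close _ _ ⟨Y, 𝟙 Y, f, Presieve.singleton_self f, by simp⟩)

theorem pullback_compl (f : Y ⟶ X) (S : ClosedSieve J X) :
    pullback f Sᶜ = (pullback f S)ᶜ := by
  refine ClosedSieve.ext (Sieve.ext fun Z g => ?_)
  change (Sᶜ).1 (g ≫ f) ↔ ((pullback f S)ᶜ).1 g
  rw [compl_apply, compl_apply]
  simp only [pullback_apply, Category.assoc]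

end ClosedSieve

/-- The subobject classifier `Ω` of `Sh(C, J)`, as an internal frame: the closed sieves. -/
def Omega : Cᵒᵖ ⥤ Frm.{max u v} where
  obj X := Frm.of (ClosedSieve J X.unop)
  map f := Frm.ofHom (ClosedSieve.pullback f.unop)
  map_id X := by
    refine Frm.ext fun S => ClosedSieve.ext ?_
    exact Sieve.pullback_id
  map_comp f g := by
    refine Frm.ext fun S => ClosedSieve.ext ?_
    exact Sieve.pullback_comp _

end ClosedSieves

/-! ### The double negation part of a frame -/

section Regular

variable {α β : Type*} [Order.Frame α] [Order.Frame β]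

/-- The regular elements (those with `¬¬ x = x`) of a frame form a frame, with joins `¬¬ ⋁ xᵢ`. -/
instance regularFrame : Order.Frame (Heyting.Regular α) where
  __ := (inferInstance : HeytingAlgebra (Heyting.Regular α))
  sSup A := Heyting.Regular.toRegular (sSup (((↑) : Heyting.Regular α → α) '' A))
  isLUB_sSup A := ⟨fun x hx => Heyting.Regular.coe_le_coe.1
      ((le_sSup (Set.mem_image_of_mem _ hx)).trans le_compl_compl),
    fun y hy => (Heyting.Regular.gi (α := α)).gc.l_le
      (sSup_le (by rintro _ ⟨x, hx, rfl⟩; exact hy hx))⟩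
  sInf A := Heyting.Regular.toRegular (sInf (((↑) : Heyting.Regular α → α) '' A))
  isGLB_sInf A := by
    have key : ∀ x ∈ A, (sInf (((↑) : Heyting.Regular α → α) '' A) : α)ᶜᶜ ≤ x.1 := fun x hx =>
      (compl_le_compl (compl_le_compl (sInf_le (Set.mem_image_of_mem _ hx)))).trans x.2.le
    exact ⟨fun x hx => Heyting.Regular.coe_le_coe.1 (key x hx),
      fun y hy => Heyting.Regular.coe_le_coe.1
        ((le_sInf (by rintro _ ⟨x, hx, rfl⟩; exact hy hx)).trans le_compl_compl)⟩

/-- A frame homomorphism that preserves pseudo-complements restricts to regular elements. -/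
def regularMap (f : FrameHom α β) (hf : ∀ a, f aᶜ = (f a)ᶜ) :
    FrameHom (Heyting.Regular α) (Heyting.Regular β) where
  toFun x := ⟨f x.1, by
    rw [Heyting.IsRegular, ← hf, ← hf, x.2.eq]⟩
  map_inf' x y := Subtype.ext (map_inf f x.1 y.1)
  map_top' := Subtype.ext (map_top f)
  map_sSup' A := Subtype.ext <| by
    change f (sSup (((↑) : Heyting.Regular α → α) '' A))ᶜᶜ =
      (sSup (((↑) : Heyting.Regular β → β) '' _))ᶜᶜ
    rw [hf, hf, map_sSup]
    congr 3
    ext b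
    constructor
    · rintro ⟨_, ⟨x, hx, rfl⟩, rfl⟩
      exact ⟨_, ⟨x, hx, rfl⟩, rfl⟩
    · rintro ⟨_, ⟨x, hx, rfl⟩, rfl⟩
      exact ⟨_, ⟨x, hx, rfl⟩, rfl⟩

end Regular

/-- The object `Ω_{¬¬}` of `Sh(C, J)`: the equaliser of `¬¬` and `id` on `Ω`, computed pointwise,
with the order inherited from `Ω`. -/
def OmegaNotNot {C : Type u} [Category.{v} C] (J : GrothendieckTopology C) :
    Cᵒᵖ ⥤ Frm.{max u v} where
  obj X := Frm.of (Heyting.Regular (ClosedSieve J X.unop))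
  map f := Frm.ofHom (regularMap (ClosedSieve.pullback f.unop) (ClosedSieve.pullback_compl f.unop))
  map_id X := by
    refine Frm.ext fun S => Subtype.ext (ClosedSieve.ext ?_)
    exact Sieve.pullback_id
  map_comp f g := by
    refine Frm.ext fun S => Subtype.ext (ClosedSieve.ext ?_)
    exact Sieve.pullback_comp _

/-! ### Internal locales -/

section InternalLocale

variable {C : Type u} [Category.{v} C]

/-- The candidate for the left adjoint `∃_f` of the transition map `L(f) : L(c) → L(d)` of
`f : d ⟶ c`; it is the left adjoint whenever there is one. -/
def existsAlong (L : Cᵒᵖ ⥤ Frm.{w}) {d c : C} (f : d ⟶ c) (y : L.obj (op d)) : L.obj (op c) :=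
  sInf {x | y ≤ L.map f.op x}

/-- Internal locales in `Sh(C, J)`: sheaves that are pointwise frames, whose transition maps are
frame homomorphisms with left adjoints satisfying Beck-Chevalley and Frobenius reciprocity. -/
structure IsInternalLocale (J : GrothendieckTopology C) (L : Cᵒᵖ ⥤ Frm.{w}) : Prop where
  isSheaf : Presieve.IsSheaf J (L ⋙ forget Frm.{w})
  adjunction {d c : C} (f : d ⟶ c) : GaloisConnection (existsAlong L f) (L.map f.op)
  beckChevalley {a b c d : C} {f : a ⟶ b} {g : a ⟶ c} {e : b ⟶ d} {h : c ⟶ d}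
    (sq : IsPullback f g e h) (x : L.obj (op b)) :
    existsAlong L g (L.map f.op x) = L.map h.op (existsAlong L e x)
  frobenius {d c : C} (f : d ⟶ c) (x : L.obj (op d)) (y : L.obj (op c)) :
    existsAlong L f (L.map f.op y ⊓ x) = existsAlong L f x ⊓ y

/-- An internal locale (more generally a presheaf of frames) is an internal Boolean algebra if it
is pointwise a Boolean algebra. -/
def IsInternalBoolean (L : Cᵒᵖ ⥤ Frm.{w}) : Prop :=
  ∀ (c : C) (x : L.obj (op c)), ∃ y, IsCompl x y

/-- Internal Stone algebras in `Sh(C, J)`: sheaves of Heyting algebras satisfying De Morgan's law.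
-/
structure IsInternalStone (J : GrothendieckTopology C) (L : Cᵒᵖ ⥤ Frm.{w}) : Prop where
  isSheaf : Presieve.IsSheaf J (L ⋙ forget Frm.{w})
  map_himp {d c : C} (f : d ⟶ c) (x y : L.obj (op c)) :
    L.map f.op (x ⇨ y) = L.map f.op x ⇨ L.map f.op y
  deMorgan (c : C) : IsStone (L.obj (op c))

end InternalLocale

/-! ### The Grothendieck construction and the coherent topology -/

section Grothendieck

variable {C : Type u} [Category.{v} C]

/-- Objects of the Grothendieck construction `𝒢(A)`: pairs `(c, x)` with `x ∈ A(c)`. -/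
structure Elt (A : Cᵒᵖ ⥤ Frm.{w}) : Type max u w where
  base : C
  fib : A.obj (op base)

namespace Elt

variable {A : Cᵒᵖ ⥤ Frm.{w}}

/-- Morphisms `(d, y) ⟶ (c, x)`: morphisms `f : d ⟶ c` with `y ≤ A(f)(x)`. -/
@[ext]
structure Hom (Y X : Elt A) : Type v where
  base : Y.base ⟶ X.base
  le : Y.fib ≤ A.map base.op X.fib

instance : Category.{v} (Elt A) where
  Hom Y X := Hom Y X
  id X := ⟨𝟙 X.base, by simp⟩
  comp {Z Y X} g f := ⟨g.base ≫ f.base, by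
    rw [op_comp, A.map_comp]
    exact g.le.trans (OrderHomClass.mono (A.map g.base.op).hom f.le)⟩
  id_comp f := Hom.ext (Category.id_comp f.base)
  comp_id f := Hom.ext (Category.comp_id f.base)
  assoc f g h := Hom.ext (Category.assoc f.base g.base h.base)

/-- The morphism `id : (c, y) ⟶ (c, x)` for `y ≤ x`. -/
def homOfLE {c : C} {y x : A.obj (op c)} (h : y ≤ x) : (⟨c, y⟩ : Elt A) ⟶ ⟨c, x⟩ :=
  ⟨𝟙 c, by simpa using h⟩

end Elt

/-- The functor `i_A : C ⥤ 𝒢(A)`, `c ↦ (c, 1)`. -/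
def topElt (A : Cᵒᵖ ⥤ Frm.{w}) : C ⥤ Elt A where
  obj c := ⟨c, ⊤⟩
  map f := ⟨f, by rw [map_top (A.map f.op).hom]⟩
  map_id _ := rfl
  map_comp _ _ := rfl

/-- The covering families of the coherent coverage on `𝒢(A)`. -/
inductive CoherentFamily (J : GrothendieckTopology C) (A : Cᵒᵖ ⥤ Frm.{w}) :
    (X : Elt A) → Presieve X → Prop
  /-- Finite families `id : (c, xᵢ) ⟶ (c, x)` with `x = ⋁ xᵢ`. -/
  | finiteJoin (c : C) (n : ℕ) (x : Fin n → A.obj (op c)) :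
      CoherentFamily J A ⟨c, ⨆ i, x i⟩
        (Presieve.ofArrows (fun i => (⟨c, x i⟩ : Elt A)) fun i => Elt.homOfLE (le_iSup x i))
  /-- Families `fᵢ : (cᵢ, A(fᵢ)(x)) ⟶ (c, x)` with `(fᵢ)` a `J`-covering family of `c`. -/
  | cartesian (X : Elt A) (R : Presieve X.base) (hR : Sieve.generate R ∈ J X.base) :
      CoherentFamily J A X fun Y f => R f.base ∧ Y.fib = A.map f.base.op X.fib

/-- The topology `K` on `𝒢(A)` generated by the coherent coverage. -/
def coherentTopology (J : GrothendieckTopology C) (A : Cᵒᵖ ⥤ Frm.{w}) :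
    GrothendieckTopology (Elt A) :=
  Precoverage.toGrothendieck ⟨fun X => {R | CoherentFamily J A X R}⟩

/-- The fibred ideal completion `Idl(A)`: at `c`, the `K`-closed sieves on `(c, 1)`. -/
def Idl (J : GrothendieckTopology C) (A : Cᵒᵖ ⥤ Frm.{w}) : Cᵒᵖ ⥤ Frm.{max u v w} :=
  (topElt A).op ⋙ Omega (coherentTopology J A)

/-- The principal sieve on `(c, 1)` generated by `id : (c, z) ⟶ (c, 1)`. -/
def principalSieve (A : Cᵒᵖ ⥤ Frm.{w}) {c : C} (z : A.obj (op c)) : Sieve ((topElt A).obj c) :=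
  Sieve.generate (Presieve.singleton (Elt.homOfLE (le_top : z ≤ ⊤)))

end Grothendieck

/-! ### De Morgan toposes -/

/-- An internal Heyting algebra structure on an object `H` of a category, in terms of generalised
elements: each `Hom(X, H)` is a Heyting algebra, naturally in `X`. -/
structure InternalHeytingAlgebra {E : Type u} [Category.{v} E] (H : E) where
  [heyting (X : E) : HeytingAlgebra (X ⟶ H)]
  comp_top {X Y : E} (f : Y ⟶ X) : f ≫ (⊤ : X ⟶ H) = ⊤
  comp_bot {X Y : E} (f : Y ⟶ X) : f ≫ (⊥ : X ⟶ H) = ⊥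
  comp_inf {X Y : E} (f : Y ⟶ X) (a b : X ⟶ H) : f ≫ (a ⊓ b) = f ≫ a ⊓ f ≫ b
  comp_sup {X Y : E} (f : Y ⟶ X) (a b : X ⟶ H) : f ≫ (a ⊔ b) = f ≫ a ⊔ f ≫ b
  comp_himp {X Y : E} (f : Y ⟶ X) (a b : X ⟶ H) : f ≫ (a ⇨ b) = f ≫ a ⇨ f ≫ b

/-- A topos is De Morgan if its subobject classifier `Ω`, with its canonical order (inclusion of
the classified subobjects), is an internal Stone algebra. -/
def IsDeMorganTopos (E : Type u) [Category.{v} E] [HasPullbacks E] : Prop :=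
  ∃ (𝒞 : Subobject.Classifier E) (H : InternalHeytingAlgebra 𝒞.Ω),
    (∀ (X : E) (a b : X ⟶ 𝒞.Ω), (H.heyting X).le a b ↔
      (Subobject.pullback a).obj 𝒞.truth_as_subobject ≤
        (Subobject.pullback b).obj 𝒞.truth_as_subobject) ∧
    ∀ X : E, @IsStone (X ⟶ 𝒞.Ω) (H.heyting X)

end GleasonCover

namespace GleasonCover

/-! The key point is that an empty sieve covers `(c, x)` in `K` exactly when `x = 0`. For "only if",
`K` is compared with `joinTopology`, where a family covers `(c, x)` when `x` is the join of the
images `∃_f y`. Beck–Chevalley and Frobenius make this a topology, and it contains the generators of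
`K`.

Hence `f : (d, x) ⟶ (c, 1)` lies in `¬R` iff `∃_f x` is disjoint from `∃_g x'` for all `g` in `R`.
By frame distributivity this condition is stable under joins, so `¬R` is principal on some `z`, and
`¬¬R` is principal on `¬z`. If `B` is Boolean, `{z, ¬z}` is a finite cover of `(c, 1)`, so `¬R ∨ ¬¬R
= 1`, which implies De Morgan's law.

`Idl` is an internal locale because it restricts the classifier of `𝒢(B)` along `c ↦ (c, 1)`, which
preserves pullbacks and sheaves. `Ω_{¬¬}` inherits its structure from `Ω` through the reflection
`¬¬`, which commutes with restriction and finite meets.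

For the Gleason cover, `(c, x)` is a subobject of `(c, 1)`, so the Stone law passes to closed sieves
on every object; maps into `Ω` are families of closed sieves with pointwise operations. -/

theorem isStone_of_compl_sup_compl_compl {H : Type*} [HeytingAlgebra H]
    (h : ∀ x : H, xᶜ ⊔ xᶜᶜ = ⊤) : IsStone H := fun x y => by
  have h₁ : (x ⊓ y)ᶜ ⊓ xᶜᶜ ≤ yᶜ := by
    rw [le_compl_iff_disjoint_right, disjoint_iff_inf_le]
    have h₂ : (x ⊓ y)ᶜ ⊓ y ≤ xᶜ := by
      rw [le_compl_iff_disjoint_right, disjoint_iff_inf_le, inf_assoc, inf_comm y x]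
      exact compl_inf_self _ |>.le
    calc (x ⊓ y)ᶜ ⊓ xᶜᶜ ⊓ y = ((x ⊓ y)ᶜ ⊓ y) ⊓ xᶜᶜ := inf_right_comm _ _ _
      _ ≤ xᶜ ⊓ xᶜᶜ := inf_le_inf_right _ h₂
      _ = ⊥ := inf_compl_self _
  calc (x ⊓ y)ᶜ = (x ⊓ y)ᶜ ⊓ (xᶜ ⊔ xᶜᶜ) := by rw [h, inf_top_eq]
    _ = (x ⊓ y)ᶜ ⊓ xᶜ ⊔ (x ⊓ y)ᶜ ⊓ xᶜᶜ := inf_sup_left _ _ _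
    _ ≤ xᶜ ⊔ yᶜ := sup_le_sup inf_le_right h₁

/-! ### Consequences of the internal locale axioms -/

section InternalLocale

variable {C : Type u} [Category.{v} C] {L : Cᵒᵖ ⥤ Frm.{w}} {J : GrothendieckTopology C}

theorem map_op_id (c : C) (x : L.obj (op c)) : L.map (𝟙 c).op x = x := by
  simp

theorem map_op_comp {c d e : C} (g : e ⟶ d) (f : d ⟶ c) (x : L.obj (op c)) :
    L.map (g ≫ f).op x = L.map g.op (L.map f.op x) := by
  simp

theorem map_op_mono {c d : C} (f : d ⟶ c) : Monotone (L.map f.op) :=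
  OrderHomClass.mono (L.map f.op).hom

theorem existsAlong_eq {d c : C} {f : d ⟶ c} {l : L.obj (op d) → L.obj (op c)}
    (h : GaloisConnection l (L.map f.op)) : existsAlong L f = l :=
  funext fun y => (h.isLeast_l (a := y)).isGLB.sInf_eq

namespace IsInternalLocale

/-- Frobenius reciprocity is the adjoint form of preservation of implication; both sides have the
same lower bounds. -/
theorem map_himp (hL : IsInternalLocale J L) {d c : C} (f : d ⟶ c) (x y : L.obj (op c)) :
    L.map f.op (x ⇨ y) = L.map f.op x ⇨ L.map f.op y :=
  eq_of_forall_le_iff fun z => by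
    rw [← hL.adjunction, le_himp_iff, le_himp_iff, ← hL.frobenius, hL.adjunction, inf_comm]

theorem existsAlong_bot (hL : IsInternalLocale J L) {d c : C} (f : d ⟶ c) :
    existsAlong L f ⊥ = ⊥ :=
  (hL.adjunction f).l_bot

theorem eq_bot_of_existsAlong (hL : IsInternalLocale J L) {d c : C} (f : d ⟶ c)
    {x : L.obj (op d)} (h : existsAlong L f x = ⊥) : x = ⊥ := by
  rw [eq_bot_iff, hL.adjunction, map_bot] at h
  exact eq_bot_iff.2 h

theorem le_map_existsAlong (hL : IsInternalLocale J L) {d c : C} (f : d ⟶ c)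
    (x : L.obj (op d)) : x ≤ L.map f.op (existsAlong L f x) :=
  (hL.adjunction f).le_u_l x

/-- The meet of two images is the image of the meet over the pullback. -/
theorem existsAlong_inf_existsAlong (hL : IsInternalLocale J L) {a b c d : C} {f : a ⟶ b}
    {g : a ⟶ c} {e : b ⟶ d} {h : c ⟶ d} (sq : IsPullback f g e h) (x : L.obj (op b))
    (y : L.obj (op c)) :
    existsAlong L e x ⊓ existsAlong L h y =
      existsAlong L e (existsAlong L f (L.map f.op x ⊓ L.map g.op y)) := by
  -- Frobenius along `e`, then Beck–Chevalley for the flipped square, then Frobenius along `f`.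
  rw [inf_comm (L.map f.op x), inf_comm, ← inf_comm, ← hL.frobenius, ← hL.beckChevalley sq.flip,
    inf_comm (L.map g.op y), hL.frobenius, inf_comm]

/-- The images for `F.op ⋙ L` are by definition those of `L` along `F.map f`, so only the squares
and the sheaf condition need hypotheses. -/
theorem of_comp {D : Type*} [Category* D] {K : GrothendieckTopology D} {L : Dᵒᵖ ⥤ Frm.{w}}
    (hL : IsInternalLocale K L) (F : C ⥤ D)
    (hF : ∀ {a b c d : C} {f : a ⟶ b} {g : a ⟶ c} {e : b ⟶ d} {h : c ⟶ d},
      IsPullback f g e h → IsPullback (F.map f) (F.map g) (F.map e) (F.map h))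
    (hs : Presieve.IsSheaf J ((F.op ⋙ L) ⋙ forget Frm.{w})) : IsInternalLocale J (F.op ⋙ L) where
  isSheaf := hs
  adjunction f := hL.adjunction (F.map f)
  beckChevalley sq x := hL.beckChevalley (hF sq) x
  frobenius f x y := hL.frobenius (F.map f) x y

/-- An element is covered by its restrictions along a covering family. -/
theorem le_of_forall_map_le (hL : IsInternalLocale J L) {c : C} {S : Sieve c} (hS : S ∈ J c)
    {x y : L.obj (op c)} (h : ∀ ⦃d : C⦄ (f : d ⟶ c), S f → L.map f.op x ≤ L.map f.op y) :
    x ≤ y := by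
  rw [← inf_eq_left]
  refine (hL.isSheaf S hS).isSeparatedFor.ext fun d f hf => ?_
  change L.map f.op (x ⊓ y) = L.map f.op x
  rw [map_inf, inf_eq_left]
  exact h f hf

end IsInternalLocale

end InternalLocale

/-! ### The internal locales of closed and of regular closed sieves -/

section Omega

variable {D : Type u} [Category.{v} D] (K : GrothendieckTopology D)

theorem omega_isSheaf : Presieve.IsSheaf K (Omega K ⋙ forget Frm.{max u v}) := by
  let e : Omega K ⋙ forget Frm.{max u v} ≅ (Functor.closedSieves K).toFunctor :=
    NatIso.ofComponents (fun X => Equiv.toIso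
      { toFun := fun S => ⟨S.1, S.2⟩
        invFun := fun S => ⟨S.1, S.2⟩
        left_inv := fun _ => rfl
        right_inv := fun _ => rfl }) (fun f => rfl)
  exact Presieve.isSheaf_iso K e.symm (classifier_isSheaf K)

variable {K}

theorem pullback_compl_compl {X Y : D} (f : Y ⟶ X) (S : ClosedSieve K X) :
    ClosedSieve.pullback f Sᶜᶜ = (ClosedSieve.pullback f S)ᶜᶜ := by
  rw [ClosedSieve.pullback_compl, ClosedSieve.pullback_compl]

theorem closedSieve_galoisConnection {X Y : D} (f : Y ⟶ X) :
    GaloisConnection (fun S : ClosedSieve K Y => ClosedSieve.close K (S.1.pushforward f))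
      (ClosedSieve.pullback f) := fun _ _ =>
  (ClosedSieve.close_le_iff _ _).trans (Sieve.galoisConnection f _ _)

theorem omega_existsAlong {X Y : D} (f : Y ⟶ X) (S : ClosedSieve K Y) :
    existsAlong (Omega K) f S = ClosedSieve.close K (S.1.pushforward f) :=
  congrFun (existsAlong_eq (L := Omega K) (f := f) (closedSieve_galoisConnection f)) S

variable (K)

theorem omega_isInternalLocale : IsInternalLocale K (Omega K) where
  isSheaf := omega_isSheaf K
  adjunction f := by
    rw [existsAlong_eq (L := Omega K) (f := f) (closedSieve_galoisConnection f)]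
    exact closedSieve_galoisConnection f
  beckChevalley {a b c d f g e h} sq S := by
    refine (omega_existsAlong g _).trans
      (Eq.trans ?_ (congrArg (ClosedSieve.pullback h) (omega_existsAlong e S).symm))
    refine ClosedSieve.ext ?_
    -- Closure commutes with pullback, which leaves Beck–Chevalley for plain sieves.
    refine Eq.trans (congrArg K.close ?_) (K.pullback_close h _)
    ext Z k
    constructor
    · rintro ⟨l, rfl, hl⟩
      exact ⟨l ≫ f, by rw [Category.assoc, Category.assoc, sq.w], hl⟩
    · rintro ⟨l, hl, hS⟩
      refine ⟨sq.lift l k hl, sq.lift_snd _ _ _, ?_⟩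
      change S.1 (sq.lift l k hl ≫ f)
      rwa [sq.lift_fst]
  frobenius {d c} f S T := by
    refine (omega_existsAlong f _).trans
      (Eq.trans ?_ (congrArg (· ⊓ T) (omega_existsAlong f S).symm))
    refine le_antisymm ((ClosedSieve.close_le_iff _ _).2 ?_) ?_
    · rintro Z _ ⟨g, rfl, hT, hS⟩
      exact ⟨K.le_close _ _ ⟨g, rfl, hS⟩, hT⟩
    · rintro Z g ⟨hS, hT⟩
      refine K.superset_covering ?_ hS
      rintro W k ⟨l, hl, hS⟩
      refine ⟨l, hl, ?_, hS⟩
      change T.1 (l ≫ f)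
      rw [hl]
      exact T.1.downward_closed hT k

/-- Composite of two adjunctions: `¬¬` is left adjoint to the inclusion of regular elements, and
`∃_f` to pullback. -/
theorem omegaNotNot_galoisConnection {X Y : D} (f : Y ⟶ X) :
    GaloisConnection (fun S : Heyting.Regular (ClosedSieve K Y) =>
      (Heyting.Regular.toRegular (existsAlong (Omega K) f S.1) :
        Heyting.Regular (ClosedSieve K X)))
      (regularMap (ClosedSieve.pullback f) (ClosedSieve.pullback_compl f)) := fun S T =>
  (Heyting.Regular.gi.gc _ T).trans ((omega_isInternalLocale K).adjunction f S.1 T.1)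

theorem omegaNotNot_existsAlong_eq {X Y : D} (f : Y ⟶ X)
    (S : Heyting.Regular (ClosedSieve K Y)) :
    existsAlong (OmegaNotNot K) f S = (Heyting.Regular.toRegular (existsAlong (Omega K) f S.1) :
      Heyting.Regular (ClosedSieve K X)) :=
  congrFun (existsAlong_eq (L := OmegaNotNot K) (f := f) (omegaNotNot_galoisConnection K f)) S

theorem omegaNotNot_isSheaf : Presieve.IsSheaf K (OmegaNotNot K ⋙ forget Frm.{max u v}) := by
  intro X S hS x hx
  have hΩ := omega_isSheaf K S hS
  let y : Presieve.FamilyOfElements (Omega K ⋙ forget Frm.{max u v}) S.arrows :=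
    fun Y f hf => (x f hf : Heyting.Regular (ClosedSieve K Y)).1
  have hy : y.Compatible := fun _ _ _ g₁ g₂ f₁ f₂ h₁ h₂ e =>
    congrArg Subtype.val (hx g₁ g₂ h₁ h₂ e)
  obtain ⟨t, ht, ht'⟩ := hΩ y hy
  -- Since `¬¬` commutes with restriction, `¬¬t` and `t` glue the same family, so they agree by
  -- separatedness.
  have hreg : Heyting.IsRegular (show ClosedSieve K X from t) := by
    refine hΩ.isSeparatedFor y _ t ?_ ht
    intro Y f hf
    have h : ClosedSieve.pullback f (t : ClosedSieve K X) = y f hf := ht f hf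
    exact (pullback_compl_compl f _).trans ((congrArg (fun T : ClosedSieve K Y => Tᶜᶜ) h).trans
      (x f hf : Heyting.Regular (ClosedSieve K Y)).2)
  refine ⟨⟨t, hreg⟩, fun Y f hf => Subtype.ext (ht f hf), ?_⟩
  intro s hs
  exact Subtype.ext (ht' _ fun Y f hf => congrArg Subtype.val (hs f hf))

theorem omegaNotNot_isInternalLocale : IsInternalLocale K (OmegaNotNot K) where
  isSheaf := omegaNotNot_isSheaf K
  adjunction f := by
    rw [existsAlong_eq (L := OmegaNotNot K) (f := f) (omegaNotNot_galoisConnection K f)]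
    exact omegaNotNot_galoisConnection K f
  beckChevalley {a b c d f g e h} sq S := by
    refine (omegaNotNot_existsAlong_eq K g _).trans (Eq.trans ?_
      (congrArg (regularMap (ClosedSieve.pullback h) (ClosedSieve.pullback_compl h))
        (omegaNotNot_existsAlong_eq K e S).symm))
    refine Subtype.ext ?_
    exact (congrArg (fun T : ClosedSieve K c => Tᶜᶜ)
      ((omega_isInternalLocale K).beckChevalley sq S.1)).trans (pullback_compl_compl h _).symm
  frobenius {d c} f S T := by
    refine (omegaNotNot_existsAlong_eq K f _).trans (Eq.trans ?_
      (congrArg (· ⊓ T) (omegaNotNot_existsAlong_eq K f S).symm))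
    refine Subtype.ext ?_
    refine (congrArg (fun T : ClosedSieve K c => Tᶜᶜ)
      ((omega_isInternalLocale K).frobenius f S.1 T.1)).trans ?_
    refine (compl_compl_inf_distrib (α := ClosedSieve K c) _ _).trans ?_
    exact congrArg (fun U : ClosedSieve K c => _ ⊓ U) T.2

theorem omegaNotNot_isInternalBoolean : IsInternalBoolean (OmegaNotNot K) := fun c =>
  have h (x : Heyting.Regular (ClosedSieve K c)) : IsCompl x xᶜ := isCompl_compl
  fun x => ⟨_, h x⟩

end Omega

/-! ### Covers in `𝒢(B)` and the sheaf `Idl(B)` -/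

section Grothendieck

variable {C : Type u} [Category.{v} C] {J : GrothendieckTopology C} {B : Cᵒᵖ ⥤ Frm.{w}}

/-- The topology on `𝒢(B)` whose covering families of `(c, x)` are those with `x = ⋁ ∃_f y`. -/
def joinTopology [HasPullbacks C] (hB : IsInternalLocale J B) : GrothendieckTopology (Elt B) where
  sieves X := {S | ∀ u : B.obj (op X.base),
    (∀ (Y : Elt B) (f : Y ⟶ X), S f → Y.fib ≤ B.map f.base.op u) → X.fib ≤ u}
  top_mem' X u h := (h X (𝟙 X) trivial).trans_eq (map_op_id X.base u)
  pullback_stable' X Z S g hS u hu := by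
    -- This is the largest `w` whose restriction along `g` meets `Z.fib` below `u`; it turns the
    -- bound `u` over `Z` into a bound over `X`, to which `hS` applies.
    let t : B.obj (op X.base) := sSup {w | B.map g.base.op w ⊓ Z.fib ≤ u}
    have ht : B.map g.base.op t ⊓ Z.fib ≤ u := by
      rw [map_sSup, sSup_inf_eq]
      refine iSup₂_le ?_
      rintro _ ⟨w, hw, rfl⟩
      exact hw
    refine le_trans (le_inf ((Elt.Hom.le g).trans (map_op_mono g.base (hS t fun Y f hf => ?_))) le_rfl) ht
    rw [← hB.adjunction]
    refine le_sSup ?_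
    change B.map g.base.op (existsAlong B f.base Y.fib) ⊓ Z.fib ≤ u
    have sq := IsPullback.of_hasPullback f.base g.base
    rw [← hB.beckChevalley sq, ← hB.frobenius, hB.adjunction]
    let W : Elt B := ⟨pullback f.base g.base, B.map (pullback.snd f.base g.base).op Z.fib ⊓
      B.map (pullback.fst f.base g.base).op Y.fib⟩
    let p : W ⟶ Y := ⟨pullback.fst f.base g.base, inf_le_right⟩
    let q : W ⟶ Z := ⟨pullback.snd f.base g.base, inf_le_left⟩
    have hpq : q ≫ g = p ≫ f := Elt.Hom.ext sq.w.symm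
    refine hu W q ?_
    change S (q ≫ g)
    rw [hpq]
    exact S.downward_closed hf p
  transitive' X S hS R hR u hu := hS u fun Y f hf => hR hf _ fun Z g hg => by
    rw [← map_op_comp]
    exact hu Z (g ≫ f) hg

/-- `K` is the least topology containing the generators. Joins are immediate; `J`-covering families
follow from separatedness of `B`. -/
theorem coherentTopology_le_joinTopology [HasPullbacks C] (hB : IsInternalLocale J B) :
    coherentTopology J B ≤ joinTopology hB := by
  rw [coherentTopology, Precoverage.toGrothendieck_eq_sInf]
  refine sInf_le ?_
  intro X S hS u hu
  cases hS with
  | finiteJoin c n x =>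
    refine iSup_le fun i => ?_
    exact (hu _ _ (Sieve.le_generate _ _ _ (Presieve.ofArrows.mk i))).trans_eq (map_op_id c u)
  | cartesian _ R hR =>
    refine hB.le_of_forall_map_le hR ?_
    rintro d _ ⟨e, k, r, hr, rfl⟩
    rw [map_op_comp, map_op_comp]
    exact map_op_mono k (hu ⟨e, B.map r.op X.fib⟩ ⟨r, le_rfl⟩ (Sieve.le_generate _ _ _ ⟨hr, rfl⟩))

theorem bot_mem_coherentTopology (X : Elt B) (hX : X.fib = ⊥) :
    (⊥ : Sieve X) ∈ coherentTopology J B X := by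
  obtain ⟨c, x⟩ := X
  -- The empty family is the case `n = 0` of the finite joins.
  have hx : x = ⨆ i : Fin 0, (Fin.elim0 i : B.obj (op c)) := by
    rw [iSup_of_empty]
    exact hX
  subst hx
  refine GrothendieckTopology.superset_covering _ ?_
    (Precoverage.generate_mem_toGrothendieck (CoherentFamily.finiteJoin c 0 _))
  rintro _ _ ⟨_, _, _, ⟨i⟩, _⟩
  exact i.elim0

theorem bot_mem_coherentTopology_iff [HasPullbacks C] (hB : IsInternalLocale J B) (X : Elt B) :
    (⊥ : Sieve X) ∈ coherentTopology J B X ↔ X.fib = ⊥ :=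
  ⟨fun h => eq_bot_iff.2 (coherentTopology_le_joinTopology hB X h ⊥ fun _ _ h => h.elim),
    bot_mem_coherentTopology X⟩

/-- Morphisms `(d, x) ⟶ (c, 1)` are the morphisms `d ⟶ c`. -/
def Elt.homTop {X : Elt B} {c : C} (f : X.base ⟶ c) : X ⟶ (topElt B).obj c :=
  ⟨f, le_top.trans_eq (map_top (B.map f.op).hom).symm⟩

theorem Elt.homTop_id_comp {X : Elt B} {c : C} (f : X.base ⟶ c) :
    Elt.homTop (𝟙 X.base) ≫ (topElt B).map f = Elt.homTop f :=
  Elt.Hom.ext (Category.id_comp f)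

theorem topElt_map_isPullback {a b c d : C} {f : a ⟶ b} {g : a ⟶ c} {e : b ⟶ d} {h : c ⟶ d}
    (sq : IsPullback f g e h) : IsPullback ((topElt B).map f) ((topElt B).map g)
      ((topElt B).map e) ((topElt B).map h) where
  w := by rw [← Functor.map_comp, sq.w, Functor.map_comp]
  isLimit' := ⟨PullbackCone.IsLimit.mk _
    (fun s => ⟨sq.lift s.fst.base s.snd.base (congrArg Elt.Hom.base s.condition),
      le_top.trans_eq (map_top (B.map _).hom).symm⟩)
    (fun s => Elt.Hom.ext (sq.lift_fst _ _ _))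
    (fun s => Elt.Hom.ext (sq.lift_snd _ _ _))
    (fun s m h₁ h₂ => Elt.Hom.ext (sq.hom_ext
      ((congrArg Elt.Hom.base h₁).trans (sq.lift_fst _ _ _).symm)
      ((congrArg Elt.Hom.base h₂).trans (sq.lift_snd _ _ _).symm)))⟩

theorem topElt_coverPreserving : CoverPreserving J (coherentTopology J B) (topElt B) where
  cover_preserve {c S} hS := by
    have h : CoherentFamily J B ((topElt B).obj c) _ :=
      .cartesian ((topElt B).obj c) S.arrows ((Sieve.generate_sieve S).symm ▸ hS)
    refine GrothendieckTopology.superset_covering _ ?_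
      (Precoverage.generate_mem_toGrothendieck h)
    rintro Z _ ⟨Y, k, f, ⟨hf, -⟩, rfl⟩
    exact ⟨Y.base, f.base, k ≫ Elt.homTop (𝟙 _), hf, by
      rw [Category.assoc]
      exact congrArg (k ≫ ·) (Elt.homTop_id_comp (B := B) f.base).symm⟩

/-- Every map `X ⟶ (Y, 1)` factors through `X ⟶ (X.base, 1)`, so compatibility can be checked over
`C`. -/
theorem topElt_compatiblePreserving : CompatiblePreserving (coherentTopology J B) (topElt B) where
  compatible ℱ Z T x hx Y₁ Y₂ X f₁ f₂ g₁ g₂ hg₁ hg₂ e := by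
    have h (Y : C) (f : X ⟶ (topElt B).obj Y) :
        ∃ g : X.base ⟶ Y, f = Elt.homTop (𝟙 X.base) ≫ (topElt B).map g :=
      ⟨f.base, (Elt.homTop_id_comp (B := B) f.base).symm⟩
    obtain ⟨f₁, rfl⟩ := h _ f₁
    obtain ⟨f₂, rfl⟩ := h _ f₂
    have h' := hx f₁ f₂ hg₁ hg₂ (by simpa [Elt.homTop_id_comp] using! congrArg Elt.Hom.base e)
    rw [op_comp, op_comp, Functor.map_comp_apply, Functor.map_comp_apply]
    exact congrArg _ h'

theorem idl_isSheaf : Presieve.IsSheaf J (Idl J B ⋙ forget Frm.{max u v w}) := by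
  have := Functor.isContinuous_of_coverPreserving
    (topElt_compatiblePreserving (J := J) (B := B)) topElt_coverPreserving
  exact Functor.op_comp_isSheaf_of_isSheaf_type (topElt B) J (K := coherentTopology J B)
    (omega_isSheaf (coherentTopology J B))

theorem idl_isInternalLocale : IsInternalLocale J (Idl J B) :=
  (omega_isInternalLocale (coherentTopology J B)).of_comp (topElt B) topElt_map_isPullback
    idl_isSheaf

end Grothendieck

/-! ### Pseudo-complements in `Idl(B)` -/

theorem sSup_inf_le_of_forall {α : Type*} [Order.Frame α] {A : Set α} {a b : α}
    (h : ∀ x ∈ A, x ⊓ a ≤ b) : sSup A ⊓ a ≤ b := by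
  rw [sSup_inf_eq]
  exact iSup₂_le h

section Grothendieck

variable {C : Type u} [Category.{v} C] {J : GrothendieckTopology C} {B : Cᵒᵖ ⥤ Frm.{w}}

theorem compl_apply_iff_fib_eq_bot [HasPullbacks C] (hB : IsInternalLocale J B) {T : Elt B}
    (R : ClosedSieve (coherentTopology J B) T) {X : Elt B} (f : X ⟶ T) :
    (Rᶜ).sieve f ↔ ∀ (Y : Elt B) (g : Y ⟶ X), R.sieve (g ≫ f) → Y.fib = ⊥ := by
  rw [ClosedSieve.compl_apply]
  exact forall₃_congr fun Y g _ => bot_mem_coherentTopology_iff hB Y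

theorem compl_apply_iff_existsAlong [HasPullbacks C] (hB : IsInternalLocale J B) {T : Elt B}
    (R : ClosedSieve (coherentTopology J B) T) {X : Elt B} (f : X ⟶ T) :
    (Rᶜ).sieve f ↔ ∀ (Y : Elt B) (g : Y ⟶ T), R.sieve g →
      existsAlong B f.base X.fib ⊓ existsAlong B g.base Y.fib = ⊥ := by
  rw [compl_apply_iff_fib_eq_bot hB]
  constructor
  · intro h Y g hg
    have sq := IsPullback.of_hasPullback f.base g.base
    -- `W.fib` has image `∃_f x ∧ ∃_g y`, and `W` maps to `X` by an arrow whose composite with `f`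
    -- is in `R`.
    let W : Elt B := ⟨pullback f.base g.base, B.map (pullback.fst f.base g.base).op X.fib ⊓
      B.map (pullback.snd f.base g.base).op Y.fib⟩
    let p : W ⟶ X := ⟨pullback.fst f.base g.base, inf_le_left⟩
    let q : W ⟶ Y := ⟨pullback.snd f.base g.base, inf_le_right⟩
    have hpq : p ≫ f = q ≫ g := Elt.Hom.ext sq.w
    have hW : W.fib = ⊥ := h W p (by rw [hpq]; exact R.sieve.downward_closed hg q)
    rw [hB.existsAlong_inf_existsAlong sq]
    change existsAlong B f.base (existsAlong B _ W.fib) = ⊥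
    rw [hW, hB.existsAlong_bot, hB.existsAlong_bot]
  · intro h Y g hg
    -- Images reflect `0`, and the image of `Y.fib` along `g ≫ f` lies below both terms of a meet
    -- that vanishes by `h`.
    refine hB.eq_bot_of_existsAlong (g ≫ f).base (eq_bot_iff.2 ?_)
    rw [← h Y _ hg]
    refine le_inf ?_ le_rfl
    rw [hB.adjunction]
    refine (Elt.Hom.le g).trans ((map_op_mono g.base (hB.le_map_existsAlong f.base X.fib)).trans ?_)
    exact (map_op_comp g.base f.base _).ge

theorem principalSieve_apply {c : C} (z : B.obj (op c)) {X : Elt B} (f : X ⟶ (topElt B).obj c) :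
    principalSieve B z f ↔ X.fib ≤ B.map f.base.op z := by
  constructor
  · rintro ⟨_, h, _, ⟨⟩, rfl⟩
    refine (Elt.Hom.le h).trans_eq ?_
    change _ = B.map (h.base ≫ 𝟙 c).op z
    rw [Category.comp_id]
  · intro h
    exact ⟨⟨c, z⟩, ⟨f.base, h⟩, _, Presieve.singleton_self _, Elt.Hom.ext (Category.comp_id f.base)⟩

theorem principalSieve_apply_iff_existsAlong (hB : IsInternalLocale J B) {c : C}
    (z : B.obj (op c)) {X : Elt B} (f : X ⟶ (topElt B).obj c) :
    principalSieve B z f ↔ (existsAlong B f.base X.fib : B.obj (op c)) ≤ z :=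
  (principalSieve_apply z f).trans (hB.adjunction (c := c) f.base X.fib z).symm

theorem compl_eq_principalSieve [HasPullbacks C] (hB : IsInternalLocale J B) {c : C}
    (R : ClosedSieve (coherentTopology J B) ((topElt B).obj c)) (z : B.obj (op c))
    (hz : z = sSup {y | ∃ (X : Elt B) (f : X ⟶ (topElt B).obj c),
      (Rᶜ).sieve f ∧ y = existsAlong B f.base X.fib}) :
    (Rᶜ).sieve = principalSieve B z := by
  ext X f
  rw [principalSieve_apply_iff_existsAlong hB]
  constructor
  · intro hf
    rw [hz]
    exact le_sSup ⟨X, f, hf, rfl⟩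
  · intro hf
    rw [compl_apply_iff_existsAlong hB]
    intro Y g hg
    refine eq_bot_iff.2 ((inf_le_inf_right _ hf).trans ?_)
    subst hz
    refine sSup_inf_le_of_forall ?_
    rintro _ ⟨X', f', hf', rfl⟩
    exact ((compl_apply_iff_existsAlong hB R f').1 hf' Y g hg).le

/-- Disjointness from every image of a member of `¬R` is disjointness from their join `z`. -/
theorem compl_compl_eq_principalSieve [HasPullbacks C] (hB : IsInternalLocale J B) {c : C}
    (R : ClosedSieve (coherentTopology J B) ((topElt B).obj c)) (z : B.obj (op c))
    (hz : z = sSup {y | ∃ (X : Elt B) (f : X ⟶ (topElt B).obj c),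
      (Rᶜ).sieve f ∧ y = existsAlong B f.base X.fib}) :
    (Rᶜᶜ).sieve = principalSieve B zᶜ := by
  ext X f
  rw [principalSieve_apply_iff_existsAlong hB, compl_apply_iff_existsAlong hB,
    le_compl_iff_disjoint_right, hz]
  refine Iff.trans ?_ (disjoint_sSup_iff (α := B.obj (op c))).symm
  constructor
  · rintro h _ ⟨Y, g, hg, rfl⟩
    exact disjoint_iff.2 (h Y g hg)
  · intro h Y g hg
    exact disjoint_iff.1 (h _ ⟨Y, g, hg, rfl⟩)

/-- Keeping `t` as a variable with an equation lets the lemma apply to `(c, ⊤)` itself. -/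
theorem mem_coherentTopology_of_sup {c : C} {x y t : B.obj (op c)} (ht : t = x ⊔ y)
    (S : Sieve (⟨c, t⟩ : Elt B))
    (hx : S (Elt.homOfLE (le_sup_left.trans_eq ht.symm : x ≤ t)))
    (hy : S (Elt.homOfLE (le_sup_right.trans_eq ht.symm : y ≤ t))) :
    S ∈ coherentTopology J B ⟨c, t⟩ := by
  have ht' : t = ⨆ i : Fin 2, ![x, y] i := by
    rw [ht, ← Finset.sup_univ_eq_iSup]
    simp [Fin.univ_succ]
  subst ht'
  refine GrothendieckTopology.superset_covering _ ?_
    (Precoverage.generate_mem_toGrothendieck (CoherentFamily.finiteJoin c 2 ![x, y]))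
  rw [Sieve.generate_le_iff]
  rintro _ _ ⟨i⟩
  fin_cases i
  · exact hx
  · exact hy

theorem compl_sup_compl_compl_topElt [HasPullbacks C] (hB : IsInternalLocale J B)
    (hB' : IsInternalBoolean B) (c : C)
    (R : ClosedSieve (coherentTopology J B) ((topElt B).obj c)) : Rᶜ ⊔ Rᶜᶜ = ⊤ := by
  let z : B.obj (op c) := sSup {y | ∃ (X : Elt B) (f : X ⟶ (topElt B).obj c),
    (Rᶜ).sieve f ∧ y = existsAlong B f.base X.fib}
  have h₁ := compl_eq_principalSieve hB R z rfl
  have h₂ := compl_compl_eq_principalSieve hB R z rfl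
  have hz : (⊤ : B.obj (op c)) = z ⊔ zᶜ := by
    obtain ⟨y, hy⟩ := hB' c z
    rw [hy.compl_eq, hy.sup_eq_top]
  refine ClosedSieve.ext ((GrothendieckTopology.close_eq_top_iff_mem _ _).2
    (mem_coherentTopology_of_sup hz _ (Or.inl ?_) (Or.inr ?_)))
  · rw [h₁]
    exact (principalSieve_apply z _).2 (map_op_id c z).ge
  · rw [h₂]
    exact (principalSieve_apply zᶜ _).2 (map_op_id c zᶜ).ge

theorem isStone_closedSieve_topElt [HasPullbacks C] (hB : IsInternalLocale J B)
    (hB' : IsInternalBoolean B) (c : C) :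
    IsStone (ClosedSieve (coherentTopology J B) ((topElt B).obj c)) :=
  isStone_of_compl_sup_compl_compl (compl_sup_compl_compl_topElt hB hB' c)

theorem idl_isInternalStone [HasPullbacks C] (hB : IsInternalLocale J B) (hB' : IsInternalBoolean B) :
    IsInternalStone J (Idl J B) where
  isSheaf := idl_isSheaf
  map_himp := idl_isInternalLocale.map_himp
  deMorgan := isStone_closedSieve_topElt hB hB'

end Grothendieck

/-! ### Descent of the Stone law along monomorphisms -/

section Mono

variable {D : Type u} [Category.{v} D] {K : GrothendieckTopology D}

theorem pullback_close_pushforward_of_mono {X Y : D} (i : Y ⟶ X) [Mono i] (S : ClosedSieve K Y) :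
    ClosedSieve.pullback i (ClosedSieve.close K (S.1.pushforward i)) = S := by
  refine ClosedSieve.ext ((K.pullback_close i _).symm.trans ?_)
  rw [(Sieve.galoisCoinsertionOfMono i).u_l_eq, K.close_eq_self_of_isClosed S.2]

/-- Pullback along a mono is surjective on closed sieves, and it preserves meets, joins and
pseudo-complements. -/
theorem isStone_closedSieve_of_mono {X Y : D} (i : Y ⟶ X) [Mono i]
    (h : IsStone (ClosedSieve K X)) : IsStone (ClosedSieve K Y) := fun S T => by
  rw [← pullback_close_pushforward_of_mono i S, ← pullback_close_pushforward_of_mono i T,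
    ← map_inf, ← ClosedSieve.pullback_compl, ← ClosedSieve.pullback_compl,
    ← ClosedSieve.pullback_compl, ← map_sup]
  exact OrderHomClass.mono (ClosedSieve.pullback i) (h _ _)

end Mono

theorem isStone_closedSieve_coherentTopology {C : Type u} [Category.{v} C] [HasPullbacks C]
    {J : GrothendieckTopology C} {B : Cᵒᵖ ⥤ Frm.{w}} (hB : IsInternalLocale J B)
    (hB' : IsInternalBoolean B) (X : Elt B) : IsStone (ClosedSieve (coherentTopology J B) X) := by
  have : Mono (Elt.homTop (𝟙 X.base)) := ⟨fun g h e => Elt.Hom.ext (by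
    have := congrArg Elt.Hom.base e
    change g.base ≫ 𝟙 _ = h.base ≫ 𝟙 _ at this
    rwa [Category.comp_id, Category.comp_id] at this)⟩
  exact isStone_closedSieve_of_mono (Elt.homTop (𝟙 X.base))
    (isStone_closedSieve_topElt hB hB' X.base)

/-! ### Maps to the subobject classifier of a sheaf topos -/

section DeMorgan

variable {D : Type u} [SmallCategory D] {K : GrothendieckTopology D}

namespace SheafHom

variable {X Y : Sheaf K (Type u)}

/-- A map to the sheaf of closed sieves, as a family of closed sieves. -/
def eval (a : X ⟶ Sheaf.Ω K) (p : Σ c : D, X.obj.obj (op c)) : ClosedSieve K p.1 :=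
  ⟨(a.hom.app (op p.1) p.2).1, (a.hom.app (op p.1) p.2).2⟩

theorem eval_injective : Function.Injective (eval (X := X)) := fun a b h => by
  ext c x
  exact Subtype.ext (congrArg ClosedSieve.sieve (congrFun h ⟨c.unop, x⟩))

/-- Naturality of a family of closed sieves. -/
def IsNatural (φ : ∀ p : Σ c : D, X.obj.obj (op c), ClosedSieve K p.1) : Prop :=
  ∀ ⦃c d : D⦄ (f : d ⟶ c) (x : X.obj.obj (op c)),
    φ ⟨d, X.obj.map f.op x⟩ = ClosedSieve.pullback f (φ ⟨c, x⟩)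

theorem eval_isNatural (a : X ⟶ Sheaf.Ω K) : IsNatural (eval a) := fun c d f x => by
  have h := NatTrans.naturality_apply a.hom f.op x
  exact ClosedSieve.ext (congrArg Subtype.val h)

/-- The map to the sheaf of closed sieves given by a natural family of closed sieves. -/
def ofFamily (φ : ∀ p : Σ c : D, X.obj.obj (op c), ClosedSieve K p.1) (hφ : IsNatural φ) :
    X ⟶ Sheaf.Ω K where
  hom :=
    { app := fun c => ↾fun x => ⟨(φ ⟨c.unop, x⟩).1, (φ ⟨c.unop, x⟩).2⟩
      naturality := fun c d f => by
        ext x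
        exact Subtype.ext (congrArg ClosedSieve.sieve (hφ f.unop x)) }

instance : LE (X ⟶ Sheaf.Ω K) := ⟨fun a b => eval a ≤ eval b⟩

instance : LT (X ⟶ Sheaf.Ω K) := ⟨fun a b => eval a < eval b⟩

instance : Top (X ⟶ Sheaf.Ω K) := ⟨ofFamily ⊤ fun _ _ f _ => (map_top (ClosedSieve.pullback f)).symm⟩

instance : Bot (X ⟶ Sheaf.Ω K) := ⟨ofFamily ⊥ fun _ _ f _ => (map_bot (ClosedSieve.pullback f)).symm⟩

instance : Min (X ⟶ Sheaf.Ω K) := ⟨fun a b => ofFamily (eval a ⊓ eval b) fun c d f x => by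
  change eval a ⟨d, _⟩ ⊓ eval b ⟨d, _⟩ = ClosedSieve.pullback f (eval a ⟨c, x⟩ ⊓ eval b ⟨c, x⟩)
  rw [eval_isNatural a, eval_isNatural b, map_inf]⟩

instance : Max (X ⟶ Sheaf.Ω K) := ⟨fun a b => ofFamily (eval a ⊔ eval b) fun c d f x => by
  change eval a ⟨d, _⟩ ⊔ eval b ⟨d, _⟩ = ClosedSieve.pullback f (eval a ⟨c, x⟩ ⊔ eval b ⟨c, x⟩)
  rw [eval_isNatural a, eval_isNatural b, map_sup]⟩

instance : HImp (X ⟶ Sheaf.Ω K) := ⟨fun a b => ofFamily (eval a ⇨ eval b) fun c d f x => by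
  change eval a ⟨d, _⟩ ⇨ eval b ⟨d, _⟩ = ClosedSieve.pullback f (eval a ⟨c, x⟩ ⇨ eval b ⟨c, x⟩)
  rw [eval_isNatural a, eval_isNatural b]
  exact ((omega_isInternalLocale K).map_himp f _ _).symm⟩

instance : Compl (X ⟶ Sheaf.Ω K) := ⟨fun a => ofFamily (eval a)ᶜ fun c d f x => by
  change (eval a ⟨d, _⟩)ᶜ = ClosedSieve.pullback f (eval a ⟨c, x⟩)ᶜ
  rw [eval_isNatural a, ClosedSieve.pullback_compl]⟩

/-- Transferred from a product of frames of closed sieves, so the Stone law can be checked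
pointwise. -/
instance : HeytingAlgebra (X ⟶ Sheaf.Ω K) :=
  eval_injective.heytingAlgebra eval Iff.rfl Iff.rfl (fun _ _ => rfl) (fun _ _ => rfl) rfl rfl
    (fun _ => rfl) (fun _ _ => rfl)

/-- The sheaf of closed sieves is an internal Heyting algebra, with pointwise operations. -/
def internalHeytingAlgebra : InternalHeytingAlgebra (Sheaf.Ω K) where
  comp_top _ := rfl
  comp_bot _ := rfl
  comp_inf _ _ _ := rfl
  comp_sup _ _ _ := rfl
  comp_himp _ _ _ := rfl

theorem isStone (hK : ∀ c : D, IsStone (ClosedSieve K c)) : IsStone (X ⟶ Sheaf.Ω K) :=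
  fun a b p => hK p.1 (eval a p) (eval b p)

theorem eval_eq_top_of_factors {S : Sheaf K (Type u)} {s : S ⟶ X}
    {t : S ⟶ (Sheaf.classifier K).Ω₀} {a : X ⟶ Sheaf.Ω K} (w : s ≫ a = t ≫ Sheaf.truth K) {c : D}
    (x : X.obj.obj (op c)) (y : S.obj.obj (op c)) (e : x = s.hom.app (op c) y) :
    eval a ⟨c, x⟩ = ⊤ := by
  subst e
  exact ClosedSieve.ext (congrArg (fun m : S ⟶ Sheaf.Ω K => (m.hom.app (op c) y).1) w)

/-- Reduces inclusion of sieves to the question of which restrictions of `x` are sent to truth. -/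
theorem eval_apply (a : X ⟶ Sheaf.Ω K) {c d : D} (x : X.obj.obj (op c)) (f : d ⟶ c) :
    (eval a ⟨c, x⟩).1 f ↔ eval a ⟨d, X.obj.map f.op x⟩ = ⊤ := by
  rw [eval_isNatural a f x, Sieve.mem_iff_pullback_eq_top]
  exact ⟨fun h => ClosedSieve.ext h, fun h => congrArg ClosedSieve.sieve h⟩

theorem exists_isPullback_truth (a : X ⟶ Sheaf.Ω K) :
    ∃ t, IsPullback t
      ((Subobject.pullback a).obj (Sheaf.classifier K).truth_as_subobject).arrow
      (Sheaf.truth K) a :=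
  ⟨Subobject.pullbackπ a _ ≫ (Subobject.underlyingIso (Sheaf.classifier K).truth).hom,
    (Subobject.isPullback a (Sheaf.classifier K).truth_as_subobject).of_iso (Iso.refl _)
    (Subobject.underlyingIso (Sheaf.classifier K).truth) (Iso.refl _) (Iso.refl _)
    (by simp) (by simp)
    (by simpa using! (Subobject.underlyingIso_hom_comp_eq_mk (Sheaf.classifier K).truth).symm)
    (by simp)⟩

/-- The order on maps to `Ω` is the inclusion of the classified subobjects. -/
theorem le_iff_pullback_truth_le (a b : X ⟶ Sheaf.Ω K) :
    a ≤ b ↔ (Subobject.pullback a).obj (Sheaf.classifier K).truth_as_subobject ≤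
        (Subobject.pullback b).obj (Sheaf.classifier K).truth_as_subobject := by
  obtain ⟨ta, ha⟩ := exists_isPullback_truth a
  obtain ⟨tb, hb⟩ := exists_isPullback_truth b
  constructor
  · intro h
    -- On the subobject classified by `a`, `a` is true, hence so is the larger `b`.
    have w : ((Subobject.pullback a).obj (Sheaf.classifier K).truth_as_subobject).arrow ≫ b =
        ta ≫ Sheaf.truth K := by
      refine eval_injective (funext fun p => ?_)
      have h₁ := eval_eq_top_of_factors ha.w.symm _ p.2 rfl
      refine (top_le_iff.1 (h₁.symm.le.trans (h _))).trans ?_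
      exact h₁.symm.trans (congrFun (congrArg eval ha.w.symm) p)
    exact Subobject.le_of_comm (hb.lift _ _ w.symm) (hb.lift_snd _ _ _)
  · intro h p d f hf
    obtain ⟨c, x⟩ := p
    rw [eval_apply] at hf ⊢
    -- Pullbacks of sheaves are computed pointwise, so a section sent to truth by `a` lifts to the
    -- subobject.
    have h₁ := (Types.isPullback_iff _ _ _ _).1
      (ha.map (sheafToPresheaf K (Type u) ⋙ (evaluation _ _).obj (op d)))
    obtain ⟨y, -, hy⟩ := h₁.2.2 PUnit.unit (X.obj.map f.op x)
      (Subtype.ext (congrArg ClosedSieve.sieve hf).symm)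
    refine eval_eq_top_of_factors hb.w.symm _ ((Subobject.ofLE _ _ h).hom.app (op d) y) ?_
    exact hy.symm.trans
      (congrArg (fun m : _ ⟶ X => m.hom.app (op d) y) (Subobject.ofLE_arrow h).symm)

end SheafHom

theorem isDeMorganTopos_sheaf (hK : ∀ c : D, IsStone (ClosedSieve K c)) :
    IsDeMorganTopos (Sheaf K (Type u)) :=
  ⟨Sheaf.classifier K, SheafHom.internalHeytingAlgebra, fun _ => SheafHom.le_iff_pullback_truth_le,
    fun _ => SheafHom.isStone hK⟩

end DeMorgan

end GleasonCover

theorem mainTheorem9 {C : Type u} [SmallCategory C] [HasFiniteLimits C]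
    (J : GrothendieckTopology C) :
    -- the ideal completion of an internal locale that is an internal Boolean algebra
    (∀ B : Cᵒᵖ ⥤ Frm.{u}, GleasonCover.IsInternalLocale J B → GleasonCover.IsInternalBoolean B →
      GleasonCover.IsInternalLocale J (GleasonCover.Idl J B) ∧
      GleasonCover.IsInternalStone J (GleasonCover.Idl J B) ∧
      -- pseudo-complements of closed sieves on `(c, 1)`
      ∀ (c : C) (R : (GleasonCover.Idl J B).obj (op c)),
        (∀ (X : GleasonCover.Elt B) (f : X ⟶ (GleasonCover.topElt B).obj c),
          (Rᶜ).sieve f ↔ ∀ (Y : GleasonCover.Elt B) (g : Y ⟶ X), R.sieve (g ≫ f) → Y.fib = ⊥) ∧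
        (∀ (X : GleasonCover.Elt B) (f : X ⟶ (GleasonCover.topElt B).obj c),
          (Rᶜ).sieve f ↔
            ∀ (Y : GleasonCover.Elt B) (g : Y ⟶ (GleasonCover.topElt B).obj c), R.sieve g →
              GleasonCover.existsAlong B f.base X.fib ⊓
                GleasonCover.existsAlong B g.base Y.fib = ⊥) ∧
        ∀ z : B.obj (op c),
          z = sSup {y | ∃ (X : GleasonCover.Elt B) (f : X ⟶ (GleasonCover.topElt B).obj c),
            (Rᶜ).sieve f ∧ y = GleasonCover.existsAlong B f.base X.fib} →
          (Rᶜ).sieve = GleasonCover.principalSieve B z ∧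
          (Rᶜᶜ).sieve = GleasonCover.principalSieve B zᶜ) ∧
    -- the case of `Ω_{¬¬}`
    GleasonCover.IsInternalLocale J (GleasonCover.OmegaNotNot J) ∧
    GleasonCover.IsInternalBoolean (GleasonCover.OmegaNotNot J) ∧
    GleasonCover.IsInternalStone J (GleasonCover.Idl J (GleasonCover.OmegaNotNot J)) ∧
    -- the Gleason cover is a De Morgan topos
    GleasonCover.IsDeMorganTopos
      (Sheaf (GleasonCover.coherentTopology J (GleasonCover.OmegaNotNot J)) (Type u)) := by
  have hΩ := GleasonCover.omegaNotNot_isInternalLocale J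
  have hΩ' := GleasonCover.omegaNotNot_isInternalBoolean J
  refine ⟨fun B hB hB' => ⟨GleasonCover.idl_isInternalLocale,
    GleasonCover.idl_isInternalStone hB hB', fun c R =>
      ⟨fun X f => GleasonCover.compl_apply_iff_fib_eq_bot hB R f,
        fun X f => GleasonCover.compl_apply_iff_existsAlong hB R f,
        fun z hz => ⟨GleasonCover.compl_eq_principalSieve hB R z hz,
          GleasonCover.compl_compl_eq_principalSieve hB R z hz⟩⟩⟩,
    hΩ, hΩ', GleasonCover.idl_isInternalStone hΩ hΩ', ?_⟩
  exact GleasonCover.isDeMorganTopos_sheaf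
    (GleasonCover.isStone_closedSieve_coherentTopology hΩ hΩ')
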